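/- All polytopes lie in $\mathbb{R}^n$. A linear functional $\lambda:\mathbb{R}^n\to\mathbb{R}$ is called generic for a polytope $P$ if it is not constant on any edge of $P$. In that case let $L(P,\lambda)$ be the poset on the vertices of $P$ in which $v\le w$ if there is a sequence of vertices $v=v_0,v_1,\dots,v_m=w$ ($m\ge 0$) such that $\lambda(v_0)<\lambda(v_1)<\cdots<\lambda(v_m)$ and each $[v_{i-1},v_i]$ is an edge of $P$. The pair $(P,\lambda)$ has the non-revisiting chain property if, whenever $x<y<z$ in $L(P,\lambda)$ and $x$ and $z$ lie in a common face $F$ of $P$, then $y$ also lies in $F$. (1) Let $P,Q\subseteq\mathbb{R}^n$ be polytopes, and let $\lambda$ be a linear functional that is generic for $P$ and for $Q$. If $(P,\lambda)$ and $(Q,\lambda)$ have the non-revisiting chain property, then the Minkowski sum $P+Q=\{p+q : p\in P,\ q\in Q\}$ is a polytope, $\lambda$ is generic for $P+Q$, and $(P+Q,\lambda)$ has the non-revisiting chain property. (2) Consequently, if $Z\subseteq\mathbb{R}^n$ is a zonotope, i.e. a Minkowski sum of finitely many line segments, and $\lambda$ is any linear functional that is generic for $Z$, then $(Z,\lambda)$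 has the non-revisiting chain property. -/

import Mathlib

open scoped Pointwise

section NonRevisitingChains

variable {E : Type*} [AddCommGroup E] [Module ℝ E] [TopologicalSpace E]

/-- A polytope: the convex hull of a finite set of points. -/
def IsPolytope (P : Set E) : Prop :=
  ∃ s : Set E, s.Finite ∧ P = convexHull ℝ s

/-- A zonotope: a Minkowski sum of finitely many line segments. -/
def IsZonotope (Z : Set E) : Prop :=
  ∃ (k : ℕ) (a b : Fin k → E), Z = ∑ i : Fin k, segment ℝ (a i) (b i)

/-- `F` is a face of `P`: it is empty, or it is the set of points of `P` at which some linear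
functional attains its maximum on `P` (the zero functional gives `P` itself). -/
def IsFace (P F : Set E) : Prop :=
  IsExposed ℝ P F

/-- An edge is a face of dimension one. -/
def IsEdge (P F : Set E) : Prop :=
  IsFace P F ∧ Module.finrank ℝ (vectorSpan ℝ F) = 1

/-- The linear functional `l` is generic for `P`: it is not constant on any edge of `P`. -/
def IsGeneric (P : Set E) (l : E →ₗ[ℝ] ℝ) : Prop :=
  ∀ F : Set E, IsEdge P F → ∃ x ∈ F, ∃ y ∈ F, l x ≠ l y

/-- The underlying set of the poset `L(P, l)`: the vertices of `P`, i.e. the points `v` of `P`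
such that some linear functional attains its maximum on `P` exactly at `v`. -/
@[ext]
structure VertexPoset (P : Set E) (l : E →ₗ[ℝ] ℝ) where
  point : E
  isVertex : point ∈ P.exposedPoints ℝ

namespace VertexPoset

variable {P : Set E} {l : E →ₗ[ℝ] ℝ}

/-- One step up: the segment `[v, w]` is an edge of `P` and `l v < l w`. -/
def Step (v w : VertexPoset P l) : Prop :=
  l v.point < l w.point ∧ IsEdge P (segment ℝ v.point w.point)

theorem le_of_chain {v w : VertexPoset P l} (h : Relation.ReflTransGen Step v w) :
    l v.point ≤ l w.point := by
  induction h with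
  | refl => exact le_rfl
  | tail _ h ih => exact ih.trans h.1.le

theorem eq_of_chain {v w : VertexPoset P l} (h : Relation.ReflTransGen Step v w)
    (h' : l w.point ≤ l v.point) : v = w := by
  rcases Relation.ReflTransGen.cases_tail h with h | ⟨u, hu, huw⟩
  · exact h.symm
  · exact absurd huw.1 (not_lt.mpr (h'.trans (le_of_chain hu)))

/-- `v ≤ w` in `L(P, l)` if there is a sequence of vertices `v = v₀, v₁, …, vₘ = w` along which `l`
strictly increases and consecutive members of which span an edge of `P`. -/
instance : PartialOrder (VertexPoset P l) where
  le v w := Relation.ReflTransGen Step v w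
  le_refl _ := Relation.ReflTransGen.refl
  le_trans _ _ _ h h' := h.trans h'
  le_antisymm _ _ h h' := eq_of_chain h (le_of_chain h')

end VertexPoset

/-- The non-revisiting chain property of `(P, l)`: if `x < y < z` in `L(P, l)` and `x`, `z` lie in
a common face `F` of `P`, then `y` lies in `F`. -/
def HasNonRevisitingChains (P : Set E) (l : E →ₗ[ℝ] ℝ) : Prop :=
  ∀ F : Set E, IsFace P F → ∀ x y z : VertexPoset P l, x < y → y < z →
    x.point ∈ F → z.point ∈ F → y.point ∈ F

end NonRevisitingChains

/-! Every vertex of `P + Q` splits as a vertex of `P` plus a vertex of `Q`, and along an edge each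
summand either stays put or moves along an edge in the same direction
(`eq_or_isEdge_of_isEdge_add`). Both projections are therefore monotone
(`VertexPoset.exists_monotone_add`). A point `p + q` lies in the face maximizing `c` iff `p` and `q`
lie in the corresponding faces, so non-revisiting passes to the sum. Segments satisfy it trivially,
and zonotopes follow by induction. -/

theorem IsPolytope.convex {E : Type*} [AddCommGroup E] [Module ℝ E] {P : Set E}
    (h : IsPolytope P) : Convex ℝ P := by
  obtain ⟨s, -, rfl⟩ := h
  exact convex_convexHull ℝ s

theorem IsPolytope.add {E : Type*} [AddCommGroup E] [Module ℝ E] {P Q : Set E}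
    (hP : IsPolytope P) (hQ : IsPolytope Q) : IsPolytope (P + Q) := by
  obtain ⟨s, hs, rfl⟩ := hP
  obtain ⟨t, ht, rfl⟩ := hQ
  exact ⟨s + t, hs.add ht, (convexHull_add s t).symm⟩

section MinkowskiSums

variable {E : Type*} [AddCommGroup E] [Module ℝ E] [TopologicalSpace E]

/-- A face of a Minkowski sum is the Minkowski sum of the faces at which the same functional
attains its maximum. -/
theorem mem_maximizers_add_iff {P Q : Set E} (c : StrongDual ℝ E) {p q : E} (hp : p ∈ P)
    (hq : q ∈ Q) :
    (∀ y ∈ P + Q, c y ≤ c (p + q)) ↔ (∀ y ∈ P, c y ≤ c p) ∧ ∀ y ∈ Q, c y ≤ c q := by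
  constructor
  · refine fun h => ⟨fun y hy => ?_, fun y hy => ?_⟩
    · have := h (y + q) (Set.add_mem_add hy hq)
      simpa using this
    · have := h (p + y) (Set.add_mem_add hp hy)
      simpa using this
  · rintro ⟨h₁, h₂⟩ _ ⟨a, ha, b, hb, rfl⟩
    simpa using add_le_add (h₁ a ha) (h₂ b hb)

theorem exists_add_of_mem_exposedPoints_add {P Q : Set E} {v : E}
    (hv : v ∈ (P + Q).exposedPoints ℝ) :
    ∃ p ∈ P.exposedPoints ℝ, ∃ q ∈ Q.exposedPoints ℝ, v = p + q := by
  obtain ⟨⟨p, hp, q, hq, rfl⟩, d, hd⟩ := hv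
  have hmax := (mem_maximizers_add_iff d hp hq).1 fun y hy => (hd y hy).1
  refine ⟨p, ⟨hp, d, fun y hy => ⟨hmax.1 y hy, fun h => ?_⟩⟩,
    q, ⟨hq, d, fun y hy => ⟨hmax.2 y hy, fun h => ?_⟩⟩, rfl⟩
  · exact add_right_cancel ((hd (y + q) (Set.add_mem_add hy hq)).2 (by simpa using h))
  · exact add_left_cancel ((hd (p + y) (Set.add_mem_add hp hy)).2 (by simpa using h))

/-- An edge of `P + Q` between two vertices projects to a point or to a parallel edge of `P`. -/
theorem eq_or_isEdge_of_isEdge_add {P Q : Set E} (hP : Convex ℝ P) {p p' q q' : E}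
    (hp : p ∈ P) (hp' : p' ∈ P) (hq : q ∈ Q) (hq' : q' ∈ Q)
    (hexp : p' + q' ∈ (P + Q).exposedPoints ℝ)
    (hedge : IsEdge (P + Q) (segment ℝ (p + q) (p' + q'))) :
    p = p' ∨ ∃ s : ℝ, 0 < s ∧ p' - p = s • ((p' + q') - (p + q)) ∧
      IsEdge P (segment ℝ p p') := by
  rcases eq_or_ne p p' with h | hne
  · exact Or.inl h
  right
  obtain ⟨c, hc⟩ := hedge.1 ⟨_, left_mem_segment ℝ _ _⟩
  have hmem : ∀ {a b : E}, a ∈ P → b ∈ Q → (∀ y ∈ P, c y ≤ c a) → (∀ y ∈ Q, c y ≤ c b) →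
      a + b ∈ segment ℝ (p + q) (p' + q') := by
    intro a b ha hb h₁ h₂
    rw [hc]
    exact ⟨Set.add_mem_add ha hb, (mem_maximizers_add_iff c ha hb).2 ⟨h₁, h₂⟩⟩
  have hv : (p + q) ∈ segment ℝ (p + q) (p' + q') := left_mem_segment ℝ _ _
  have hw : (p' + q') ∈ segment ℝ (p + q) (p' + q') := right_mem_segment ℝ _ _
  rw [hc] at hv hw
  obtain ⟨hcp, hcq⟩ := (mem_maximizers_add_iff c hp hq).1 hv.2
  obtain ⟨hcp', -⟩ := (mem_maximizers_add_iff c hp' hq').1 hw.2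
  set u := (p' + q') - (p + q) with hu
  -- With `q` held fixed, `a + q` lies on the edge, so the `c`-maximal face of `P` lies on a ray
  -- from `p`.
  have hline : ∀ a ∈ P, (∀ y ∈ P, c y ≤ c a) → ∃ t : ℝ, 0 ≤ t ∧ a - p = t • u := by
    intro a ha h
    have := hmem ha hq h hcq
    rw [segment_eq_image'] at this
    obtain ⟨t, ht, hta⟩ := this
    refine ⟨t, ht.1, ?_⟩
    have h2 : p + q + t • u = a + q := hta
    have h3 : t • u = a + q - (p + q) := by rw [← h2]; abel
    rw [h3]; abel
  obtain ⟨s, hs0, hs⟩ := hline p' hp' hcp'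
  have hspos : 0 < s := by
    refine lt_of_le_of_ne hs0 fun h => hne ?_
    rw [← h, zero_smul, sub_eq_zero] at hs
    exact hs.symm
  refine ⟨s, hspos, hs, fun _ => ⟨c, Set.Subset.antisymm ?_ ?_⟩, ?_⟩
  · intro x hx
    refine ⟨hP.segment_subset hp hp' hx, fun y hy => ?_⟩
    obtain ⟨a, b, ha, hb, hab, rfl⟩ := hx
    have h1 := mul_le_mul_of_nonneg_left (hcp y hy) ha
    have h2 := mul_le_mul_of_nonneg_left (hcp' y hy) hb
    have h3 : a * c y + b * c y = c y := by rw [← add_mul, hab, one_mul]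
    simp only [map_add, map_smul, smul_eq_mul]
    linarith
  · rintro f ⟨hf, hcf⟩
    obtain ⟨t, ht0, ht⟩ := hline f hf hcf
    -- A functional `d` exposing `p' + q'` increases along `u`, so no point of the face lies beyond
    -- `p'` on the ray.
    obtain ⟨-, d, hd⟩ := hexp
    have hdu : 0 < d u := by
      have h := hd (p + q) (Set.add_mem_add hp hq)
      rw [hu, map_sub, sub_pos]
      refine lt_of_le_of_ne h.1 fun heq => ?_
      have h0 : u = 0 := by rw [hu, h.2 heq.ge, sub_self]
      rw [h0, smul_zero, sub_eq_zero] at hs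
      exact hne hs.symm
    have hdf : d f ≤ d p' := by
      simpa using (hd (f + q') (Set.add_mem_add hf hq')).1
    have hts : t ≤ s := by
      have h1 := congrArg d ht
      have h2 := congrArg d hs
      simp only [map_sub, map_smul, smul_eq_mul] at h1 h2
      exact le_of_mul_le_mul_right (by linarith) hdu
    rw [segment_eq_image']
    refine ⟨t / s, ⟨by positivity, (div_le_one hspos).2 hts⟩, ?_⟩
    simp only
    rw [hs, smul_smul, div_mul_cancel₀ t hspos.ne', ← ht]
    abel
  · rw [vectorSpan_segment]
    exact finrank_span_singleton (by simpa [vsub_eq_sub, sub_eq_zero] using hne.symm)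

theorem VertexPoset.eq_or_step_of_step_add {P Q : Set E} {l : E →ₗ[ℝ] ℝ} (hP : Convex ℝ P)
    {v w : VertexPoset (P + Q) l} {p p' : VertexPoset P l} {q q' : E} (hq : q ∈ Q) (hq' : q' ∈ Q)
    (hv : v.point = p.point + q) (hw : w.point = p'.point + q') (h : Step v w) :
    p = p' ∨ Step p p' := by
  obtain ⟨hlt, hedge⟩ := h
  have hexp := w.isVertex
  rw [hv, hw] at hedge hlt
  rw [hw] at hexp
  rcases eq_or_isEdge_of_isEdge_add hP p.isVertex.1 p'.isVertex.1 hq hq' hexp hedge with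
    h | ⟨s, hs, hsub, hE⟩
  · exact Or.inl (VertexPoset.ext h)
  · refine Or.inr ⟨?_, hE⟩
    have h1 := congrArg l hsub
    rw [map_sub, map_smul, smul_eq_mul, map_sub] at h1
    have h2 := mul_pos hs (sub_pos.2 hlt)
    linarith

theorem VertexPoset.exists_add {P Q : Set E} {l : E →ₗ[ℝ] ℝ} (v : VertexPoset (P + Q) l) :
    ∃ pq : VertexPoset P l × VertexPoset Q l, v.point = pq.1.point + pq.2.point := by
  obtain ⟨p, hp, q, hq, h⟩ := exists_add_of_mem_exposedPoints_add v.isVertex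
  exact ⟨(⟨p, hp⟩, ⟨q, hq⟩), h⟩

theorem VertexPoset.exists_monotone_add {P Q : Set E} (l : E →ₗ[ℝ] ℝ) (hP : Convex ℝ P)
    (hQ : Convex ℝ Q) :
    ∃ (f : VertexPoset (P + Q) l → VertexPoset P l) (g : VertexPoset (P + Q) l → VertexPoset Q l),
      (∀ v, v.point = (f v).point + (g v).point) ∧ Monotone f ∧ Monotone g := by
  -- Any choice of decompositions works: the step lemma applies to all of them.
  choose fg hfg using VertexPoset.exists_add (P := P) (Q := Q) (l := l)
  refine ⟨fun v => (fg v).1, fun v => (fg v).2, hfg, ?_, ?_⟩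
  · intro v w hvw
    induction hvw with
    | refl => exact le_rfl
    | @tail a b _ h ih =>
      refine ih.trans ?_
      rcases eq_or_step_of_step_add hP (fg a).2.isVertex.1 (fg b).2.isVertex.1
        (hfg a) (hfg b) h with h | h
      · exact h.le
      · exact Relation.ReflTransGen.single h
  · intro v w hvw
    induction hvw with
    | refl => exact le_rfl
    | @tail a b _ h ih =>
      refine ih.trans ?_
      -- Generalizing over `R` transports the step from `P + Q` to `Q + P`, whose vertex posets are
      -- different types.
      have key : ∀ {R : Set E} (hR : R = Q + P) (v w : VertexPoset R l), Step v w →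
          v.point = (fg a).2.point + (fg a).1.point → w.point = (fg b).2.point + (fg b).1.point →
          (fg a).2 = (fg b).2 ∨ Step (fg a).2 (fg b).2 := by
        rintro _ rfl v w h h1 h2
        exact eq_or_step_of_step_add hQ (fg a).1.isVertex.1 (fg b).1.isVertex.1 h1 h2 h
      rcases key (add_comm P Q) a b h ((hfg a).trans (add_comm _ _))
        ((hfg b).trans (add_comm _ _)) with h | h
      · exact h.le
      · exact Relation.ReflTransGen.single h

/-- Closing up the non-revisiting condition under `≤`. -/
theorem HasNonRevisitingChains.mem_of_le {P F : Set E} {l : E →ₗ[ℝ] ℝ}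
    (h : HasNonRevisitingChains P l) (hF : IsFace P F) {x y z : VertexPoset P l} (hxy : x ≤ y)
    (hyz : y ≤ z) (hx : x.point ∈ F) (hz : z.point ∈ F) : y.point ∈ F := by
  rcases hxy.eq_or_lt with rfl | hxy
  · exact hx
  rcases hyz.eq_or_lt with rfl | hyz
  · exact hz
  exact h F hF x y z hxy hyz hx hz

theorem HasNonRevisitingChains.add {P Q : Set E} {l : E →ₗ[ℝ] ℝ} (hP : Convex ℝ P)
    (hQ : Convex ℝ Q) (hPl : HasNonRevisitingChains P l) (hQl : HasNonRevisitingChains Q l) :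
    HasNonRevisitingChains (P + Q) l := by
  intro F hF x y z hxy hyz hx hz
  obtain ⟨f, g, hfg, hf, hg⟩ := VertexPoset.exists_monotone_add l hP hQ
  obtain ⟨c, rfl⟩ := hF ⟨_, hx⟩
  have hx' := hx.2
  have hz' := hz.2
  rw [hfg x, mem_maximizers_add_iff c (f x).isVertex.1 (g x).isVertex.1] at hx'
  rw [hfg z, mem_maximizers_add_iff c (f z).isVertex.1 (g z).isVertex.1] at hz'
  have h1 := hPl.mem_of_le (F := {a ∈ P | ∀ b ∈ P, c b ≤ c a}) (fun _ => ⟨c, rfl⟩) (hf hxy.le)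
    (hf hyz.le) ⟨(f x).isVertex.1, hx'.1⟩ ⟨(f z).isVertex.1, hz'.1⟩
  have h2 := hQl.mem_of_le (F := {a ∈ Q | ∀ b ∈ Q, c b ≤ c a}) (fun _ => ⟨c, rfl⟩) (hg hxy.le)
    (hg hyz.le) ⟨(g x).isVertex.1, hx'.2⟩ ⟨(g z).isVertex.1, hz'.2⟩
  refine ⟨y.isVertex.1, ?_⟩
  rw [hfg y, mem_maximizers_add_iff c (f y).isVertex.1 (g y).isVertex.1]
  exact ⟨h1.2, h2.2⟩

/-- A face of the left summand with at least two points, a translate of which lies in an edge of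
the sum, is an edge on which a generic functional is not constant. -/
theorem IsGeneric.exists_ne_of_translate_subset {P A F : Set E} {l : E →ₗ[ℝ] ℝ}
    (hPl : IsGeneric P l) (hA : IsFace P A) (hA' : A.Nontrivial) {b : E}
    (hAF : b +ᵥ A ⊆ F) (hF : Module.finrank ℝ (vectorSpan ℝ F) = 1) :
    ∃ x ∈ F, ∃ y ∈ F, l x ≠ l y := by
  have hle : vectorSpan ℝ A ≤ vectorSpan ℝ F := by
    rw [← vectorSpan_vadd (k := ℝ) A b]
    exact vectorSpan_mono ℝ hAF
  have : Module.Finite ℝ (vectorSpan ℝ F) := Module.finite_of_finrank_pos (by omega)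
  have hle1 := Submodule.finrank_mono hle
  have hne : Module.finrank ℝ (vectorSpan ℝ A) ≠ 0 := by
    intro h0
    have : Module.Finite ℝ (vectorSpan ℝ A) := Submodule.finiteDimensional_of_le hle
    rw [Submodule.finrank_eq_zero] at h0
    obtain ⟨x, hx, y, hy, hxy⟩ := hA'
    have := vsub_mem_vectorSpan ℝ hx hy
    rw [h0, Submodule.mem_bot, vsub_eq_sub, sub_eq_zero] at this
    exact hxy this
  obtain ⟨x, hx, y, hy, hxy⟩ := hPl A ⟨hA, by omega⟩
  refine ⟨b + x, hAF ⟨x, hx, rfl⟩, b + y, hAF ⟨y, hy, rfl⟩, ?_⟩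
  simpa using hxy

theorem IsGeneric.add {P Q : Set E} {l : E →ₗ[ℝ] ℝ} (hP : IsGeneric P l) (hQ : IsGeneric Q l) :
    IsGeneric (P + Q) l := by
  rintro F ⟨hF, hdim⟩
  have hFn : F.Nontrivial := by
    by_contra h
    rw [Set.not_nontrivial_iff] at h
    rw [vectorSpan_of_subsingleton ℝ h, finrank_bot] at hdim
    exact zero_ne_one hdim
  obtain ⟨c, rfl⟩ := hF hFn.nonempty
  obtain ⟨v, hv, w, hw, hvw⟩ := hFn
  obtain ⟨⟨p, hp, q, hq, rfl⟩, hv⟩ := hv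
  obtain ⟨⟨p', hp', q', hq', rfl⟩, hw⟩ := hw
  obtain ⟨hcp, hcq⟩ := (mem_maximizers_add_iff c hp hq).1 hv
  obtain ⟨hcp', hcq'⟩ := (mem_maximizers_add_iff c hp' hq').1 hw
  -- Two distinct points of the face differ in some summand; the `c`-maximal face of that summand is
  -- nontrivial and has a translate inside the edge.
  by_cases h : p = p'
  · have hqq : q ≠ q' := by rintro rfl; exact hvw (by rw [h])
    refine hQ.exists_ne_of_translate_subset (A := {a ∈ Q | ∀ b ∈ Q, c b ≤ c a})
      (fun _ => ⟨c, rfl⟩) ⟨q, ⟨hq, hcq⟩, q', ⟨hq', hcq'⟩, hqq⟩ (b := p) ?_ hdim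
    rintro _ ⟨a, ⟨ha, hca⟩, rfl⟩
    exact ⟨Set.add_mem_add hp ha, (mem_maximizers_add_iff c hp ha).2 ⟨hcp, hca⟩⟩
  · refine hP.exists_ne_of_translate_subset (A := {a ∈ P | ∀ b ∈ P, c b ≤ c a})
      (fun _ => ⟨c, rfl⟩) ⟨p, ⟨hp, hcp⟩, p', ⟨hp', hcp'⟩, h⟩ (b := q) ?_ hdim
    rintro _ ⟨a, ⟨ha, hca⟩, rfl⟩
    change q + a ∈ _
    rw [add_comm q a]
    exact ⟨Set.add_mem_add ha hq, (mem_maximizers_add_iff c ha hq).2 ⟨hca, hcq⟩⟩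

theorem eq_or_eq_of_mem_exposedPoints_segment {a b x : E}
    (hx : x ∈ (segment ℝ a b).exposedPoints ℝ) : x = a ∨ x = b := by
  obtain ⟨⟨s, t, hs, ht, hst, rfl⟩, d, hd⟩ := hx
  have ha := hd a (left_mem_segment ℝ a b)
  have hb := hd b (right_mem_segment ℝ a b)
  simp only [map_add, map_smul, smul_eq_mul] at ha hb
  have hs' : s = 1 - t := by linarith
  subst hs'
  rcases le_total (d a) (d b) with h | h
  · exact Or.inr (hb.2 (by nlinarith)).symm
  · exact Or.inl (ha.2 (by nlinarith)).symm

/-- A segment has at most two vertices, so no chain `x < y < z` exists. -/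
theorem HasNonRevisitingChains.segment (a b : E) (l : E →ₗ[ℝ] ℝ) :
    HasNonRevisitingChains (segment ℝ a b) l := by
  intro F _ x y z hxy hyz hx hz
  have h1 := eq_or_eq_of_mem_exposedPoints_segment x.isVertex
  have h2 := eq_or_eq_of_mem_exposedPoints_segment y.isVertex
  have h3 := eq_or_eq_of_mem_exposedPoints_segment z.isVertex
  have hxy' : x.point ≠ y.point := fun h => hxy.ne (VertexPoset.ext h)
  have hyz' : y.point ≠ z.point := fun h => hyz.ne (VertexPoset.ext h)
  have hxz' : x.point ≠ z.point := fun h => (hxy.trans hyz).ne (VertexPoset.ext h)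
  grind

theorem HasNonRevisitingChains.sum_segment {ι : Type*} (s : Finset ι) (a b : ι → E)
    (l : E →ₗ[ℝ] ℝ) : HasNonRevisitingChains (∑ i ∈ s, _root_.segment ℝ (a i) (b i)) l := by
  classical
  induction s using Finset.induction_on with
  | empty =>
    -- The empty Minkowski sum is a degenerate segment.
    have h : (0 : Set E) = _root_.segment ℝ 0 0 := by rw [segment_same]; rfl
    rw [Finset.sum_empty, h]
    exact HasNonRevisitingChains.segment 0 0 l
  | insert i s hi ih =>
    rw [Finset.sum_insert hi]
    exact (HasNonRevisitingChains.segment (a i) (b i) l).add (convex_segment _ _)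
      (convex_sum _ fun j _ => convex_segment _ _) ih

end MinkowskiSums

theorem mainTheorem12 (n : ℕ) :
    (∀ (P Q : Set (EuclideanSpace ℝ (Fin n))) (l : EuclideanSpace ℝ (Fin n) →ₗ[ℝ] ℝ),
      IsPolytope P → IsPolytope Q → IsGeneric P l → IsGeneric Q l →
      HasNonRevisitingChains P l → HasNonRevisitingChains Q l →
      IsPolytope (P + Q) ∧ IsGeneric (P + Q) l ∧ HasNonRevisitingChains (P + Q) l) ∧
    (∀ (Z : Set (EuclideanSpace ℝ (Fin n))) (l : EuclideanSpace ℝ (Fin n) →ₗ[ℝ] ℝ),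
      IsZonotope Z → IsGeneric Z l → HasNonRevisitingChains Z l) := by
  refine ⟨fun P Q l hP hQ hPl hQl hPc hQc =>
    ⟨hP.add hQ, hPl.add hQl, hPc.add hP.convex hQ.convex hQc⟩, ?_⟩
  rintro _ l ⟨k, a, b, rfl⟩ -
  exact HasNonRevisitingChains.sum_segment Finset.univ a b l
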